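/- Let $\mathcal X$ be a set of datasets with a symmetric neighboring relation $\sim$ for which there are two distinct neighboring datasets. A mechanism $M$ is a randomized map from $\mathcal X$ to some measurable outcome space $\mathcal Y$ (which may depend on $M$). - $M$ is $(\varepsilon,\delta)$-DP if $\Pr[M(x)\in S]\le e^{\varepsilon}\Pr[M(x')\in S]+\delta$ for all $x\sim x'$ and all measurable $S\subseteq\mathcal Y$, and $\varepsilon$-DP if it is $(\varepsilon,0)$-DP. - $M$ is $\varepsilon$-bounded range ($\varepsilon$-BR) if $$\Pr[M(x)\in S_1]\,\Pr[M(x')\in S_2]\le e^{\varepsilon}\,\Pr[M(x)\in S_2]\,\Pr[M(x')\in S_1]$$ for all $x\sim x'$ and all measurable $S_1,S_2\subseteq\mathcal Y$. (For discrete outcomes this says $\frac{\Pr[M(x)=y_1]}{\Pr[M(x')=y_1]}\le e^{\varepsilon}\frac{\Pr[M(x)=y_2]}{\Pr[M(x')=y_2]}$ for all outcomes $y_1,y_2$.) Let $\mathrm{DP}$ and $\mathrm{BR}$ denote the classes of all $\varepsilon$-DP and of all $\varepsilon$-BR mechanisms, with the same $\varepsilon$. For classes $\mathcal M_1,\mathcal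 M_2,\mathcal M_3$ let $(\mathcal M_1,\mathcal M_2,\mathcal M_3)$ be the class of their adaptive compositions: on input $x$ first $y_1\sim M_1(x)$ is drawn, then $y_2\sim M_2(x,y_1)$, then $y_3\sim M_3(x,y_1,y_2)$, and $(y_1,y_2,y_3)$ is released, where $M_1\in\mathcal M_1$, $M_2(\cdot,y_1)\in\mathcal M_2$ for every $y_1$, $M_3(\cdot,y_1,y_2)\in\mathcal M_3$ for every $(y_1,y_2)$, and $M_2$, $M_3$ depend measurably on the previous outcomes. For a mechanism $M$ and a class $\mathcal M$ put $$\delta_{\mathrm{opt}}(M;\varepsilon_g)=\inf\{\delta\ge 0: M\text{ is }(\varepsilon_g,\delta)\text{-DP}\},\qquad \delta_{\mathrm{opt}}(\mathcal M;\varepsilon_g)=\sup_{M\in\mathcal M}\delta_{\mathrm{opt}}(M;\varepsilon_g).$$ Let $0\le\varepsilon_g<\varepsilon$, let $q_{\varepsilon,t}=\dfrac{1-e^{t-\varepsilon}}{1-e^{-\varepsilon}}$ (the same formula with $2\varepsilon$ in place of $\varepsilon$ gives $q_{2\varepsilon,\varepsilon}$), and define $$x(t)=q_{2\varepsilon,\varepsilon}\left(q_{\varepsilon,t}\,q_{\varepsilon,\frac{\varepsilon_g-t}{2}}^2(1-e^{-\varepsilon})+(1-q_{\varepsilon,t})\,q_{\varepsilon,\frac{\varepsilon_g+\varepsilon-t}{2}}^2(1-e^{-\varepsilon})\right),$$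 $$y(t)=q_{2\varepsilon,\varepsilon}\left(q_{\varepsilon,t}(1-e^{\varepsilon_g-\varepsilon-t})+(1-q_{\varepsilon,t})\,q_{\varepsilon,\frac{\varepsilon_g+\varepsilon-t}{2}}^2(1-e^{-\varepsilon})\right),$$ $$z(t)=(1-q_{2\varepsilon,\varepsilon})\,q_{\varepsilon,t}\,q_{\varepsilon,\varepsilon+\frac{\varepsilon_g-t}{2}}^2(1-e^{-\varepsilon}).$$ Then $$\delta_{\mathrm{opt}}(\mathrm{DP},\mathrm{BR},\mathrm{BR};\varepsilon_g)>\delta_{\mathrm{opt}}(\mathrm{BR},\mathrm{DP},\mathrm{BR};\varepsilon_g),$$ and moreover $$\delta_{\mathrm{opt}}(\mathrm{DP},\mathrm{BR},\mathrm{BR};\varepsilon_g)=\begin{cases}x(\varepsilon/2)+z\left(\frac{2\varepsilon+\varepsilon_g}{3}\right)&\text{if }\varepsilon_g\ge\varepsilon/2,\\ y\left(\frac{\varepsilon+\varepsilon_g}{3}\right)+z\left(\frac{2\varepsilon+\varepsilon_g}{3}\right)&\text{if }\varepsilon_g<\varepsilon/2,\end{cases}$$ $$\delta_{\mathrm{opt}}(\mathrm{BR},\mathrm{DP},\mathrm{BR};\varepsilon_g)=\begin{cases}\max\{x(\varepsilon/2),\,y(\varepsilon_g)+z(\varepsilon_g)\}&\text{if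 }\varepsilon_g\ge\varepsilon/2,\\ \max\{x(\varepsilon_g),\,y(\varepsilon/2)+z(\varepsilon/2)\}&\text{if }\varepsilon_g<\varepsilon/2.\end{cases}$$ -/

import Mathlib

open MeasureTheory ProbabilityTheory

universe u v

noncomputable section

/-- A randomized algorithm with inputs in `X`: a measurable outcome space `Out` and, for every
input `x`, the law `law x` of the outcome on input `x`. -/
structure Mechanism (X : Type v) where
  Out : Type u
  [measurableSpace : MeasurableSpace Out]
  law : X → Measure Out
  [isProbabilityMeasure : ∀ x, IsProbabilityMeasure (law x)]

attribute [instance] Mechanism.measurableSpace Mechanism.isProbabilityMeasure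

/-- `M` is `(ε, δ)`-differentially private for the neighboring relation `Nbr`. -/
def IsDP {X : Type v} (Nbr : X → X → Prop) (M : Mechanism.{u, v} X) (ε δ : ℝ) : Prop :=
  ∀ x x', Nbr x x' → ∀ S : Set M.Out, MeasurableSet S →
    (M.law x).real S ≤ Real.exp ε * (M.law x').real S + δ

/-- `M` is `ε`-bounded range for the neighboring relation `Nbr`. The inequality
`P(y₁) / P'(y₁) ≤ e ^ ε * (P(y₂) / P'(y₂))` between likelihood ratios is written with cleared
denominators and on events, so that it makes sense for outcome spaces that are not discrete; on a
discrete outcome space it is the same as the inequality for all pairs of single outcomes. -/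
def IsBR {X : Type v} (Nbr : X → X → Prop) (M : Mechanism.{u, v} X) (ε : ℝ) : Prop :=
  ∀ x x', Nbr x x' → ∀ S₁ S₂ : Set M.Out, MeasurableSet S₁ → MeasurableSet S₂ →
    (M.law x).real S₁ * (M.law x').real S₂ ≤
      Real.exp ε * ((M.law x).real S₂ * (M.law x').real S₁)

/-- The class of all `ε`-DP mechanisms. -/
def classDP {X : Type v} (Nbr : X → X → Prop) (ε : ℝ) : Set (Mechanism.{u, v} X) :=
  {M | IsDP Nbr M ε 0}

/-- The class of all `ε`-BR mechanisms. -/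
def classBR {X : Type v} (Nbr : X → X → Prop) (ε : ℝ) : Set (Mechanism.{u, v} X) :=
  {M | IsBR Nbr M ε}

/-- The second mechanism of an adaptive composition: a mechanism for every
outcome `y : Y` seen before, depending measurably on `y`. -/
structure AdaptiveMechanism (X : Type v) (Y : Type u) [MeasurableSpace Y] where
  Out : Type u
  [measurableSpace : MeasurableSpace Out]
  law : X → Kernel Y Out
  [isMarkovKernel : ∀ x, IsMarkovKernel (law x)]

attribute [instance] AdaptiveMechanism.measurableSpace AdaptiveMechanism.isMarkovKernel

/-- The mechanism `M₂(·, y)` that is run once the outcome `y` has been seen. -/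
def AdaptiveMechanism.given {X : Type v} {Y : Type u} [MeasurableSpace Y]
    (M₂ : AdaptiveMechanism.{u, v} X Y) (y : Y) : Mechanism.{u, v} X where
  Out := M₂.Out
  law := fun x => M₂.law x y

/-- The mechanism `x ↦ (M₁(x), M₂(x, M₁(x)))`, which releases both outcomes. -/
def Mechanism.andThen {X : Type v} (M₁ : Mechanism.{u, v} X)
    (M₂ : AdaptiveMechanism.{u, v} X M₁.Out) : Mechanism.{u, v} X where
  Out := M₁.Out × M₂.Out
  law := fun x => M₁.law x ⊗ₘ M₂.law x

/-- The class `(C₁, C₂)` of adaptively selected mechanisms: `M₁` is in `C₁`, and `M₂(·, y)` is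
in `C₂` for every outcome `y` of `M₁`. -/
def adaptive {X : Type v} (C₁ C₂ : Set (Mechanism.{u, v} X)) : Set (Mechanism.{u, v} X) :=
  {M | ∃ M₁ ∈ C₁, ∃ M₂ : AdaptiveMechanism.{u, v} X M₁.Out,
    (∀ y, M₂.given y ∈ C₂) ∧ M = M₁.andThen M₂}

/-- The class `(C₁, C₂, C₃)`: three adaptively selected mechanisms, in this order. -/
def adaptive₃ {X : Type v} (C₁ C₂ C₃ : Set (Mechanism.{u, v} X)) : Set (Mechanism.{u, v} X) :=
  adaptive (adaptive C₁ C₂) C₃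

/-- The optimal privacy parameter `δ_opt(M; εg)` of a mechanism. -/
def deltaOptMech {X : Type v} (Nbr : X → X → Prop) (M : Mechanism.{u, v} X) (εg : ℝ) : ℝ :=
  sInf {δ : ℝ | 0 ≤ δ ∧ IsDP Nbr M εg δ}

/-- The optimal privacy parameter `δ_opt(C; εg)` of a class of mechanisms. -/
def deltaOpt {X : Type v} (Nbr : X → X → Prop) (C : Set (Mechanism.{u, v} X)) (εg : ℝ) : ℝ :=
  sSup {d : ℝ | ∃ M ∈ C, d = deltaOptMech Nbr M εg}

/-- `q_{ε, t}`, the probability that generalized randomized response outputs 0 on input 0. -/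
def qRR (ε t : ℝ) : ℝ := (1 - Real.exp (t - ε)) / (1 - Real.exp (-ε))

/-- The function `x(t)`. -/
def xFun (ε εg t : ℝ) : ℝ :=
  qRR (2 * ε) ε *
    (qRR ε t * qRR ε ((εg - t) / 2) ^ 2 * (1 - Real.exp (-ε)) +
      (1 - qRR ε t) * qRR ε ((εg + ε - t) / 2) ^ 2 * (1 - Real.exp (-ε)))

/-- The function `y(t)`. -/
def yFun (ε εg t : ℝ) : ℝ :=
  qRR (2 * ε) ε *
    (qRR ε t * (1 - Real.exp (εg - ε - t)) +
      (1 - qRR ε t) * qRR ε ((εg + ε - t) / 2) ^ 2 * (1 - Real.exp (-ε)))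

/-- The function `z(t)`. -/
def zFun (ε εg t : ℝ) : ℝ :=
  (1 - qRR (2 * ε) ε) * qRR ε t * qRR ε (ε + (εg - t) / 2) ^ 2 * (1 - Real.exp (-ε))

end

/-!
If the likelihood ratio of `P` with respect to `Q` lies in `[exp (t - E), exp t]`, then `(P, Q)` is
a post-processing of generalized randomized response with parameters `E` and `t`. An `ε`-DP
mechanism has `E = 2ε` and `t = ε`; an `ε`-BR mechanism has `E = ε` and some `t ∈ [0, ε]`, which
depends on the pair of neighbors. So the worst adaptive compositions consist of generalized
randomized responses, and `δ_opt` is a maximum over the parameters `t` of the BR components; the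
last of these is maximized out in closed form.

If the DP component comes first, the parameter of the next component may depend on its outcome, and
`δ_opt` is a sum `max U + max L` over the two outcomes. If the BR component comes first, one
parameter has to serve both outcomes, and `δ_opt` is `max (U + L)`. Here `U + L = x`, which by
`y + z = x` holds on both sides of `t = εg`. The maximum of `x` at `ε / 2` is read off a formula
involving `cosh`, those of `y` and `z` come from inequalities of AM-GM type. The inequality is
strict since `L` has its only maximum at `(2 * ε + εg) / 3`, which is not `ε / 2`.
-/

theorem one_sub_exp_neg_pos {E : ℝ} (hE : 0 < E) : 0 < 1 - Real.exp (-E) := by simpa using hE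

theorem qRR_mem_Icc {E t : ℝ} (ht : t ∈ Set.Icc 0 E) : qRR E t ∈ Set.Icc (0 : ℝ) 1 := by
  have hE : Real.exp (-E) ≤ 1 := by simpa using ht.1.trans ht.2
  have htE : Real.exp (t - E) ≤ 1 := by simpa using ht.2
  have hle : Real.exp (-E) ≤ Real.exp (t - E) := Real.exp_le_exp.2 (by linarith [ht.1])
  exact ⟨div_nonneg (by linarith) (by linarith), div_le_one_of_le₀ (by linarith) (by linarith)⟩

theorem qRR_mul {E : ℝ} (hE : 0 < E) (t : ℝ) :
    qRR E t * (1 - Real.exp (-E)) = 1 - Real.exp (t - E) :=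
  div_mul_cancel₀ _ (one_sub_exp_neg_pos hE).ne'

theorem one_sub_qRR_mul {E : ℝ} (hE : 0 < E) (t : ℝ) :
    (1 - qRR E t) * (1 - Real.exp (-E)) = Real.exp (t - E) - Real.exp (-E) := by
  rw [sub_mul, qRR_mul hE]
  ring

theorem one_sub_exp_neg_mul_qRR {E : ℝ} (hE : 0 < E) (t : ℝ) :
    1 - Real.exp (-t) * qRR E t = Real.exp (E - t) * (1 - qRR E t) := by
  refine mul_right_cancel₀ (one_sub_exp_neg_pos hE).ne' ?_
  calc (1 - Real.exp (-t) * qRR E t) * (1 - Real.exp (-E))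
      = 1 - Real.exp (-E) - Real.exp (-t) * (1 - Real.exp (t - E)) := by
        rw [← qRR_mul hE t]
        ring
    _ = Real.exp (E - t) * (Real.exp (t - E) - Real.exp (-E)) := by
        rw [mul_sub, mul_sub, ← Real.exp_add, ← Real.exp_add, ← Real.exp_add]
        ring_nf
        rw [Real.exp_zero]
        ring
    _ = _ := by rw [← one_sub_qRR_mul hE t, mul_assoc]

theorem mul_iSup_add_mul_iSup_le {ι κ : Type*} [Nonempty ι] [Nonempty κ] {f : ι → ℝ} {g : κ → ℝ}
    {a b c : ℝ} (ha : 0 ≤ a) (hb : 0 ≤ b) (h : ∀ i j, a * f i + b * g j ≤ c) :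
    a * (⨆ i, f i) + b * ⨆ j, g j ≤ c := by
  rw [Real.mul_iSup_of_nonneg ha, Real.mul_iSup_of_nonneg hb, ← le_sub_iff_add_le]
  refine ciSup_le fun i => ?_
  rw [le_sub_comm]
  exact ciSup_le fun j => by linarith [h i j]

section LikelihoodRatio

variable {Y : Type*} [MeasurableSpace Y]

theorem measure_le_iff_real {μ ν : Measure Y} [IsFiniteMeasure μ] [IsFiniteMeasure ν] :
    μ ≤ ν ↔ ∀ S, MeasurableSet S → μ.real S ≤ ν.real S := by
  refine Measure.le_iff.trans (forall₂_congr fun S _ => ?_)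
  exact (ENNReal.toReal_le_toReal (measure_ne_top _ _) (measure_ne_top _ _)).symm

theorem integral_sub_integral_le_of_measure_le {μ ν : Measure Y} [IsFiniteMeasure μ] (hνμ : ν ≤ μ)
    {φ : Y → ℝ} {c : ℝ} (hφ : Integrable φ μ) (hc : ∀ y, φ y ≤ c) :
    ∫ y, φ y ∂μ - ∫ y, φ y ∂ν ≤ c * (μ.real Set.univ - ν.real Set.univ) := by
  have : IsFiniteMeasure ν := isFiniteMeasure_of_le μ hνμ
  have hmono : ∫ y, (c - φ y) ∂ν ≤ ∫ y, (c - φ y) ∂μ :=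
    integral_mono_measure hνμ (ae_of_all _ fun y => sub_nonneg.2 (hc y))
      ((integrable_const c).sub hφ)
  rw [integral_sub (integrable_const c) hφ,
    integral_sub (integrable_const c) (hφ.mono_measure hνμ)] at hmono
  simp only [integral_const, smul_eq_mul] at hmono
  linarith

/-- The likelihood ratio of `P` with respect to `Q` lies between `exp (t - E)` and `exp t`. This is
expressed on events, so that no densities are needed. -/
structure RatioBounded (E t : ℝ) (P Q : Measure Y) : Prop where
  le : ∀ S, MeasurableSet S → P.real S ≤ Real.exp t * Q.real S
  ge : ∀ S, MeasurableSet S → Real.exp (t - E) * Q.real S ≤ P.real S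

namespace RatioBounded

variable {E t : ℝ} {P Q : Measure Y}

theorem refl (ht : t ∈ Set.Icc 0 E) (P : Measure Y) : RatioBounded E t P P where
  le _ _ := le_mul_of_one_le_left measureReal_nonneg (Real.one_le_exp ht.1)
  ge _ _ := mul_le_of_le_one_left measureReal_nonneg (by simpa using ht.2)

theorem symm (h : RatioBounded E t P Q) : RatioBounded E (E - t) Q P where
  le S hS := by
    rw [← neg_sub t E, Real.exp_neg, ← div_eq_inv_mul, le_div_iff₀' (Real.exp_pos _)]
    exact h.ge S hS
  ge S hS := by
    rw [sub_sub_cancel_left, Real.exp_neg, inv_mul_le_iff₀ (Real.exp_pos _)]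
    exact h.le S hS

section IsProbabilityMeasure

variable [IsProbabilityMeasure P] [IsProbabilityMeasure Q]

theorem mem_Icc (h : RatioBounded E t P Q) : t ∈ Set.Icc 0 E := by
  have hle := h.le _ MeasurableSet.univ
  have hge := h.ge _ MeasurableSet.univ
  simp only [probReal_univ, mul_one, Real.one_le_exp_iff, Real.exp_le_one_iff] at hle hge
  exact ⟨hle, by linarith⟩

theorem le_smul (h : RatioBounded E t P Q) : P ≤ (Real.exp t).toNNReal • Q :=
  measure_le_iff_real.2 fun S hS => by
    rw [measureReal_nnreal_smul_apply, Real.coe_toNNReal _ (Real.exp_pos t).le]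
    exact h.le S hS

theorem smul_le (h : RatioBounded E t P Q) : (Real.exp (t - E)).toNNReal • Q ≤ P :=
  measure_le_iff_real.2 fun S hS => by
    rw [measureReal_nnreal_smul_apply, Real.coe_toNNReal _ (Real.exp_pos _).le]
    exact h.ge S hS

theorem integrable_left (h : RatioBounded E t P Q) {φ : Y → ℝ} (hφ : Integrable φ Q) :
    Integrable φ P :=
  hφ.smul_measure_nnreal.mono_measure h.le_smul

theorem integral_sub_exp_mul_integral_le (h : RatioBounded E t P Q) {φ : Y → ℝ} {c : ℝ}
    (hφ : Integrable φ Q) (hc : ∀ y, φ y ≤ c) :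
    ∫ y, φ y ∂P - Real.exp (t - E) * ∫ y, φ y ∂Q ≤ c * (1 - Real.exp (t - E)) := by
  simpa [integral_smul_nnreal_measure, NNReal.smul_def, (Real.exp_pos _).le] using
    integral_sub_integral_le_of_measure_le h.smul_le (h.integrable_left hφ) hc

theorem exp_mul_integral_sub_integral_le (h : RatioBounded E t P Q) {φ : Y → ℝ} {c : ℝ}
    (hφ : Integrable φ Q) (hc : ∀ y, φ y ≤ c) :
    Real.exp t * ∫ y, φ y ∂Q - ∫ y, φ y ∂P ≤ c * (Real.exp t - 1) := by
  simpa [integral_smul_nnreal_measure, NNReal.smul_def, (Real.exp_pos _).le] using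
    integral_sub_integral_le_of_measure_le h.le_smul hφ.smul_measure_nnreal hc

-- The positive measures `P - exp (t - E) • Q` and `exp t • Q - P`, normalized, are the two rows of
-- a Markov kernel which maps the two laws of generalized randomized response to `P` and `Q`.
theorem integral_sub_le (h : RatioBounded E t P Q) (hE : 0 < E) {g k : Y → ℝ}
    (hg : Integrable g Q) (hk : Integrable k Q) {s c₁ c₂ : ℝ}
    (h₁ : ∀ y, g y - Real.exp (s - t) * k y ≤ c₁)
    (h₂ : ∀ y, g y - Real.exp (s + E - t) * k y ≤ c₂) :
    ∫ y, g y ∂P - Real.exp s * ∫ y, k y ∂Q ≤ qRR E t * c₁ + (1 - qRR E t) * c₂ := by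
  have integral_split (μ : Measure Y) (hg : Integrable g μ) (hk : Integrable k μ) (r : ℝ) :
      ∫ y, (g y - r * k y) ∂μ = ∫ y, g y ∂μ - r * ∫ y, k y ∂μ := by
    rw [integral_sub hg (hk.const_mul r), integral_const_mul]
  have integrable_sub (r : ℝ) : Integrable (fun y => g y - r * k y) Q := hg.sub (hk.const_mul r)
  have hlow := h.integral_sub_exp_mul_integral_le (integrable_sub _) h₁
  have hupp := h.exp_mul_integral_sub_integral_le (integrable_sub _) h₂
  rw [integral_split P (h.integrable_left hg) (h.integrable_left hk),
    integral_split Q hg hk] at hlow hupp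
  refine le_of_mul_le_mul_right ?_ (one_sub_exp_neg_pos hE)
  calc (∫ y, g y ∂P - Real.exp s * ∫ y, k y ∂Q) * (1 - Real.exp (-E))
      = (∫ y, g y ∂P - Real.exp (s - t) * ∫ y, k y ∂P -
            Real.exp (t - E) * (∫ y, g y ∂Q - Real.exp (s - t) * ∫ y, k y ∂Q)) +
          Real.exp (-E) * (Real.exp t * (∫ y, g y ∂Q - Real.exp (s + E - t) * ∫ y, k y ∂Q) -
            (∫ y, g y ∂P - Real.exp (s + E - t) * ∫ y, k y ∂P)) := by
        simp only [Real.exp_sub, Real.exp_add, Real.exp_neg]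
        field_simp
        ring
    _ ≤ c₁ * (1 - Real.exp (t - E)) + Real.exp (-E) * (c₂ * (Real.exp t - 1)) := by
        gcongr
    _ = (qRR E t * c₁ + (1 - qRR E t) * c₂) * (1 - Real.exp (-E)) := by
        rw [add_mul, mul_right_comm, mul_right_comm (1 - qRR E t), qRR_mul hE, one_sub_qRR_mul hE,
          Real.exp_sub, Real.exp_neg]
        ring

end IsProbabilityMeasure

end RatioBounded

end LikelihoodRatio

theorem isDP_zero_iff {X : Type v} {Nbr : X → X → Prop} (hsymm : ∀ x x', Nbr x x' → Nbr x' x)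
    {M : Mechanism.{u, v} X} {ε : ℝ} :
    IsDP Nbr M ε 0 ↔ ∀ x x', Nbr x x' → RatioBounded (2 * ε) ε (M.law x) (M.law x') := by
  refine ⟨fun h x x' hx => ⟨fun S hS => by simpa using h x x' hx S hS, fun S hS => ?_⟩,
    fun h x x' hx S hS => by simpa using (h x x' hx).le S hS⟩
  rw [show ε - 2 * ε = -ε by ring, Real.exp_neg, inv_mul_le_iff₀ (Real.exp_pos _)]
  simpa using h x' x (hsymm x x' hx) S hS

section BoundedRange

variable {Y : Type*} [MeasurableSpace Y] {P Q : Measure Y} {ε : ℝ}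

theorem RatioBounded.mul_le {t : ℝ} (h : RatioBounded ε t P Q) {S₁ S₂ : Set Y}
    (h₁ : MeasurableSet S₁) (h₂ : MeasurableSet S₂) :
    P.real S₁ * Q.real S₂ ≤ Real.exp ε * (P.real S₂ * Q.real S₁) := by
  calc P.real S₁ * Q.real S₂
      ≤ (Real.exp t * Q.real S₁) * (Real.exp (ε - t) * P.real S₂) :=
        mul_le_mul (h.le S₁ h₁) (h.symm.le S₂ h₂) measureReal_nonneg (by positivity)
    _ = Real.exp (t + (ε - t)) * (P.real S₂ * Q.real S₁) := by
        rw [Real.exp_add]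
        ring
    _ = Real.exp ε * (P.real S₂ * Q.real S₁) := by rw [add_sub_cancel]

-- `exp t` is the supremum of the likelihood ratio over the events of positive probability.
theorem exists_ratioBounded [IsProbabilityMeasure P] [IsProbabilityMeasure Q]
    (h : ∀ S₁ S₂, MeasurableSet S₁ → MeasurableSet S₂ →
      P.real S₁ * Q.real S₂ ≤ Real.exp ε * (P.real S₂ * Q.real S₁)) :
    ∃ t, RatioBounded ε t P Q := by
  set ratios : Set ℝ := {r | ∃ S, MeasurableSet S ∧ 0 < Q.real S ∧ r = P.real S / Q.real S}
  have hle (S : Set Y) (hS : MeasurableSet S) : P.real S ≤ Real.exp ε * Q.real S := by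
    simpa using h S Set.univ hS MeasurableSet.univ
  have one_mem : (1 : ℝ) ∈ ratios := ⟨Set.univ, MeasurableSet.univ, by simp, by simp⟩
  have hbdd : BddAbove ratios := by
    refine ⟨Real.exp ε, ?_⟩
    rintro r ⟨S, hS, hpos, rfl⟩
    exact (div_le_iff₀ hpos).2 (hle S hS)
  have hpos : 0 < sSup ratios := zero_lt_one.trans_le (le_csSup hbdd one_mem)
  refine ⟨Real.log (sSup ratios), fun S hS => ?_, fun S hS => ?_⟩
  · rw [Real.exp_log hpos]
    rcases (measureReal_nonneg (μ := Q) (s := S)).eq_or_lt with hQ | hQ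
    · simpa [← hQ] using hle S hS
    · exact (div_le_iff₀ hQ).1 (le_csSup hbdd ⟨S, hS, hQ, rfl⟩)
  · rw [Real.exp_sub, Real.exp_log hpos, div_mul_eq_mul_div, div_le_iff₀ (Real.exp_pos _)]
    rcases (measureReal_nonneg (μ := Q) (s := S)).eq_or_lt with hQ | hQ
    · rw [← hQ, mul_zero]
      positivity
    · rw [← le_div_iff₀ hQ]
      refine csSup_le ⟨1, one_mem⟩ ?_
      rintro r ⟨S', hS', hQ', rfl⟩
      rw [div_le_div_iff₀ hQ' hQ]
      linarith [h S' S hS' hS]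

end BoundedRange

theorem isBR_iff {X : Type v} {Nbr : X → X → Prop} {M : Mechanism.{u, v} X} {ε : ℝ} :
    IsBR Nbr M ε ↔ ∀ x x', Nbr x x' → ∃ t, RatioBounded ε t (M.law x) (M.law x') :=
  ⟨fun h x x' hx => exists_ratioBounded (h x x' hx),
    fun h x x' hx _ _ h₁ h₂ => (h x x' hx).elim fun _ ht => ht.mul_le h₁ h₂⟩

section HockeyStick

variable {Y Z : Type*} [MeasurableSpace Y] [MeasurableSpace Z]

/-- The hockey-stick divergence `sup_S (P S - exp s * Q S)` of level `exp s`: for `s = ε`, the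
least `δ` in the `(ε, δ)`-DP inequality `P S ≤ exp ε * Q S + δ`. -/
noncomputable def hockeyStick (s : ℝ) (P Q : Measure Y) : ℝ :=
  ⨆ S : {S : Set Y // MeasurableSet S}, (P.real S - Real.exp s * Q.real S)

variable {s δ : ℝ} {P Q : Measure Y}

theorem hockeyStick_le (h : ∀ S, MeasurableSet S → P.real S - Real.exp s * Q.real S ≤ δ) :
    hockeyStick s P Q ≤ δ :=
  have : Nonempty {S : Set Y // MeasurableSet S} := ⟨⟨∅, .empty⟩⟩
  ciSup_le fun S => h S S.2

variable [IsProbabilityMeasure P]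

theorem le_hockeyStick {S : Set Y} (hS : MeasurableSet S) :
    P.real S - Real.exp s * Q.real S ≤ hockeyStick s P Q := by
  refine le_ciSup (f := fun S : {S : Set Y // MeasurableSet S} =>
    P.real S - Real.exp s * Q.real S) ⟨1, ?_⟩ ⟨S, hS⟩
  rintro _ ⟨S, rfl⟩
  exact (sub_le_self _ (by positivity)).trans measureReal_le_one

theorem hockeyStick_le_one : hockeyStick s P Q ≤ 1 :=
  hockeyStick_le fun _ _ => (sub_le_self _ (by positivity)).trans measureReal_le_one

theorem hockeyStick_map_le {f : Y → Z} (hf : Measurable f) :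
    hockeyStick s (P.map f) (Q.map f) ≤ hockeyStick s P Q :=
  hockeyStick_le fun S hS => by
    rw [map_measureReal_apply hf hS, map_measureReal_apply hf hS]
    exact le_hockeyStick (hf hS)

end HockeyStick

section Composition

variable {Y Z W : Type*} [MeasurableSpace Y] [MeasurableSpace Z] [MeasurableSpace W] {s δ : ℝ}
  {P Q : Measure Y} {κ κ' : Kernel Y Z} [IsMarkovKernel κ]

theorem hockeyStick_compProd_assoc [IsProbabilityMeasure P] {η η' : Kernel (Y × Z) W}
    [IsMarkovKernel η] :
    hockeyStick s (P ⊗ₘ κ ⊗ₘ η) (Q ⊗ₘ κ' ⊗ₘ η') =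
      hockeyStick s (P ⊗ₘ (κ ⊗ₖ η)) (Q ⊗ₘ (κ' ⊗ₖ η')) := by
  refine le_antisymm ?_ ?_
  · rw [← Measure.compProd_assoc, ← Measure.compProd_assoc]
    exact hockeyStick_map_le (MeasurableEquiv.measurable _)
  · rw [← Measure.compProd_assoc', ← Measure.compProd_assoc']
    exact hockeyStick_map_le (MeasurableEquiv.measurable _)

theorem integrable_real_preimage_prodMk [IsFiniteMeasure P] {S : Set (Y × Z)}
    (hS : MeasurableSet S) : Integrable (fun y => (κ y).real (Prod.mk y ⁻¹' S)) P :=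
  .of_bound (Kernel.measurable_kernel_prodMk_left hS).ennreal_toReal.aestronglyMeasurable 1
    (ae_of_all _ fun y => by
      rw [Real.norm_of_nonneg measureReal_nonneg]
      exact measureReal_le_one)

theorem measureReal_compProd [SFinite P] {S : Set (Y × Z)} (hS : MeasurableSet S) :
    (P ⊗ₘ κ).real S = ∫ y, (κ y).real (Prod.mk y ⁻¹' S) ∂P := by
  simp only [measureReal_def]
  rw [integral_toReal (Kernel.measurable_kernel_prodMk_left hS).aemeasurable
    (ae_of_all _ fun y => measure_lt_top _ _), ← Measure.compProd_apply hS]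

namespace RatioBounded

variable [IsProbabilityMeasure P] [IsProbabilityMeasure Q] {E t : ℝ}

theorem hockeyStick_le_max (h : RatioBounded E t P Q) (hE : 0 < E) :
    hockeyStick s P Q ≤
      qRR E t * max 0 (1 - Real.exp (s - t)) +
        (1 - qRR E t) * max 0 (1 - Real.exp (s + E - t)) := by
  refine hockeyStick_le fun S hS => ?_
  have indicator_sub_le (r : ℝ) (y : Y) :
      S.indicator (1 : Y → ℝ) y - r * S.indicator (1 : Y → ℝ) y ≤ max 0 (1 - r) := by
    by_cases hy : y ∈ S <;> simp [hy]
  have hind : Integrable (S.indicator (1 : Y → ℝ)) Q := (integrable_const 1).indicator hS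
  simpa only [integral_indicator_one hS] using
    h.integral_sub_le hE hind hind (indicator_sub_le _) (indicator_sub_le _)

theorem hockeyStick_compProd_le [IsMarkovKernel κ'] (h : RatioBounded E t P Q) (hE : 0 < E)
    (hδ : ∀ y y', qRR E t * hockeyStick (s - t) (κ y) (κ' y) +
      (1 - qRR E t) * hockeyStick (s + E - t) (κ y') (κ' y') ≤ δ) :
    hockeyStick s (P ⊗ₘ κ) (Q ⊗ₘ κ') ≤ δ := by
  have : Nonempty Y := nonempty_of_isProbabilityMeasure P
  have hq := qRR_mem_Icc h.mem_Icc
  have le_iSup_hockeyStick (r : ℝ) (y : Y) :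
      hockeyStick r (κ y) (κ' y) ≤ ⨆ y, hockeyStick r (κ y) (κ' y) :=
    le_ciSup (f := fun y => hockeyStick r (κ y) (κ' y))
      ⟨1, Set.forall_mem_range.2 fun _ => hockeyStick_le_one⟩ y
  refine hockeyStick_le fun S hS => ?_
  rw [measureReal_compProd hS, measureReal_compProd hS]
  refine (h.integral_sub_le hE (integrable_real_preimage_prodMk hS)
    (integrable_real_preimage_prodMk hS) (fun y => ?_) (fun y => ?_)).trans
    (mul_iSup_add_mul_iSup_le hq.1 (sub_nonneg.2 hq.2) hδ)
  all_goals exact (le_hockeyStick (measurable_prodMk_left hS)).trans (le_iSup_hockeyStick _ y)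

end RatioBounded

end Composition

section PrivacyParameter

variable {X : Type v} {Nbr : X → X → Prop} {C : Set (Mechanism.{u, v} X)}
  {M : Mechanism.{u, v} X} {s δ : ℝ}

theorem isDP_iff_hockeyStick_le :
    IsDP Nbr M s δ ↔ ∀ x x', Nbr x x' → hockeyStick s (M.law x) (M.law x') ≤ δ := by
  refine forall₃_congr fun x x' _ => ⟨fun h => hockeyStick_le fun S hS => ?_, fun h S hS => ?_⟩
  · linarith [h S hS]
  · linarith [(le_hockeyStick (s := s) (P := M.law x) (Q := M.law x') hS).trans h]

theorem isDP_one : IsDP Nbr M s 1 :=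
  isDP_iff_hockeyStick_le.2 fun _ _ _ => hockeyStick_le_one

theorem deltaOptMech_le (hδ : 0 ≤ δ) (h : IsDP Nbr M s δ) : deltaOptMech Nbr M s ≤ δ :=
  csInf_le ⟨0, fun _ h => h.1⟩ ⟨hδ, h⟩

theorem deltaOpt_le (hδ : 0 ≤ δ)
    (h : ∀ M ∈ C, ∀ x x', Nbr x x' → hockeyStick s (M.law x) (M.law x') ≤ δ) :
    deltaOpt Nbr C s ≤ δ := by
  refine Real.sSup_le ?_ hδ
  rintro _ ⟨M, hM, rfl⟩
  exact deltaOptMech_le hδ (isDP_iff_hockeyStick_le.2 (h M hM))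

theorem hockeyStick_le_deltaOpt (hM : M ∈ C) {x x' : X} (hx : Nbr x x') :
    hockeyStick s (M.law x) (M.law x') ≤ deltaOpt Nbr C s := by
  have le_deltaOptMech : hockeyStick s (M.law x) (M.law x') ≤ deltaOptMech Nbr M s :=
    le_csInf ⟨1, zero_le_one, isDP_one⟩ fun _ hδ => isDP_iff_hockeyStick_le.1 hδ.2 x x' hx
  refine le_deltaOptMech.trans (le_csSup ⟨1, ?_⟩ ⟨M, hM, rfl⟩)
  rintro _ ⟨M', -, rfl⟩
  exact deltaOptMech_le zero_le_one isDP_one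

end PrivacyParameter

section RandomizedResponse

variable {E : ℝ}

/-- The probability that generalized randomized response outputs `true`; the input of the
mechanism enters as a bit. -/
noncomputable def grrProb (E : ℝ) (t : Set.Icc 0 E) : Bool → unitInterval
  | true => ⟨qRR E t, qRR_mem_Icc t.2⟩
  | false => ⟨Real.exp (-t) * qRR E t, unitInterval.mul_mem
      ⟨(Real.exp_pos _).le, Real.exp_le_one_iff.2 (neg_nonpos.2 t.2.1)⟩ (qRR_mem_Icc t.2)⟩

/-- The law of the output of generalized randomized response on a bit. The likelihood ratio of the
laws on `true` and `false` is `exp t` at the output `true` and `exp (t - E)` at `false`. -/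
noncomputable def grrMeasure (E : ℝ) (t : Set.Icc 0 E) (b : Bool) : Measure (ULift.{u} Bool) :=
  bernoulliMeasure ⟨true⟩ ⟨false⟩ (grrProb E t b)

instance (t : Set.Icc 0 E) (b : Bool) : IsProbabilityMeasure (grrMeasure.{u} E t b) :=
  inferInstanceAs (IsProbabilityMeasure (bernoulliMeasure _ _ _))

variable (hE : 0 < E) (t : Set.Icc 0 E) (s : ℝ)

include hE in
theorem integral_grrMeasure_sub (g k : ULift.{u} Bool → ℝ) :
    ∫ y, g y ∂(grrMeasure E t true) - Real.exp s * ∫ y, k y ∂(grrMeasure E t false) =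
      qRR E t * (g ⟨true⟩ - Real.exp (s - t) * k ⟨true⟩) +
        (1 - qRR E t) * (g ⟨false⟩ - Real.exp (s + E - t) * k ⟨false⟩) := by
  simp only [grrMeasure, integral_bernoulliMeasure, grrProb, smul_eq_mul,
    one_sub_exp_neg_mul_qRR hE]
  rw [sub_eq_add_neg s t, Real.exp_add s (-t), add_sub_assoc s, Real.exp_add s (E - t)]
  ring

include hE in
theorem grrMeasure_real_sub (S : Set (ULift.{u} Bool)) :
    (grrMeasure E t true).real S - Real.exp s * (grrMeasure E t false).real S =
      qRR E t * ((1 - Real.exp (s - t)) * S.indicator 1 ⟨true⟩) +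
        (1 - qRR E t) * ((1 - Real.exp (s + E - t)) * S.indicator 1 ⟨false⟩) := by
  rw [← integral_indicator_one (.of_discrete : MeasurableSet S),
    ← integral_indicator_one (.of_discrete : MeasurableSet S), integral_grrMeasure_sub hE]
  ring

include hE in
theorem ratioBounded_grrMeasure :
    RatioBounded E t (grrMeasure.{u} E t true) (grrMeasure.{u} E t false) := by
  have hq := qRR_mem_Icc t.2
  have hexp : Real.exp (-E) ≤ 1 := Real.exp_le_one_iff.2 (neg_nonpos.2 hE.le)
  have hexp' : 1 ≤ Real.exp E := Real.one_le_exp hE.le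
  refine ⟨fun S _ => ?_, fun S _ => ?_⟩
  · rw [← sub_nonpos, grrMeasure_real_sub hE, sub_self, Real.exp_zero, sub_self, zero_mul,
      mul_zero, zero_add, add_sub_cancel_left]
    exact mul_nonpos_of_nonneg_of_nonpos (sub_nonneg.2 hq.2)
      (mul_nonpos_of_nonpos_of_nonneg (sub_nonpos.2 hexp')
        (Set.indicator_nonneg (fun _ _ => zero_le_one) _))
  · rw [← sub_nonneg, grrMeasure_real_sub hE, sub_add_cancel, sub_self, Real.exp_zero, sub_self,
      zero_mul, mul_zero, add_zero, sub_sub_cancel_left]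
    exact mul_nonneg hq.1 (mul_nonneg (sub_nonneg.2 hexp)
      (Set.indicator_nonneg (fun _ _ => zero_le_one) _))

include hE in
theorem le_hockeyStick_grrMeasure :
    qRR E t * (1 - Real.exp (s - t)) ≤
      hockeyStick s (grrMeasure.{u} E t true) (grrMeasure.{u} E t false) := by
  refine le_of_eq_of_le ?_ (le_hockeyStick (S := {⟨true⟩}) .of_discrete)
  rw [grrMeasure_real_sub hE]
  simp

include hE in
theorem le_hockeyStick_grrMeasure_compProd {Z : Type*} [MeasurableSpace Z]
    (κ κ' : Kernel (ULift.{u} Bool) Z) [IsMarkovKernel κ] [IsMarkovKernel κ'] :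
    qRR E t * hockeyStick (s - t) (κ ⟨true⟩) (κ' ⟨true⟩) +
        (1 - qRR E t) * hockeyStick (s + E - t) (κ ⟨false⟩) (κ' ⟨false⟩) ≤
      hockeyStick s (grrMeasure E t true ⊗ₘ κ) (grrMeasure E t false ⊗ₘ κ') := by
  have : Nonempty {A : Set Z // MeasurableSet A} := ⟨⟨∅, .empty⟩⟩
  have hq := qRR_mem_Icc t.2
  refine mul_iSup_add_mul_iSup_le hq.1 (sub_nonneg.2 hq.2) fun A B => ?_
  let S : Set (ULift.{u} Bool × Z) := {⟨true⟩} ×ˢ A.1 ∪ {⟨false⟩} ×ˢ B.1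
  have hS : MeasurableSet S :=
    (MeasurableSet.of_discrete.prod A.2).union (MeasurableSet.of_discrete.prod B.2)
  refine le_of_eq_of_le ?_ (le_hockeyStick hS)
  rw [measureReal_compProd hS, measureReal_compProd hS, integral_grrMeasure_sub hE]
  simp [S]

/-- Generalized randomized response whose parameter depends on a previous outcome. -/
noncomputable def grrKernel {Y : Type*} [MeasurableSpace Y] [DiscreteMeasurableSpace Y] (E : ℝ)
    (t : Y → Set.Icc 0 E) (b : Bool) : Kernel Y (ULift.{u} Bool) :=
  ⟨fun y => grrMeasure E (t y) b, .of_discrete⟩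

instance {Y : Type*} [MeasurableSpace Y] [DiscreteMeasurableSpace Y] (t : Y → Set.Icc 0 E)
    (b : Bool) : IsMarkovKernel (grrKernel.{u} E t b) :=
  ⟨fun y => inferInstanceAs (IsProbabilityMeasure (grrMeasure E (t y) b))⟩

/-- Generalized randomized response as a mechanism, telling `x₀` apart from the other inputs. -/
noncomputable def grr {X : Type v} (x₀ : X) (E : ℝ) (t : Set.Icc 0 E) : Mechanism.{u, v} X where
  Out := ULift.{u} Bool
  law x := open Classical in grrMeasure E t (decide (x = x₀))

/-- The adaptive version of `grr`, with a parameter that depends on the previous outcome. -/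
noncomputable def adaptiveGrr {X : Type v} {Y : Type u} [MeasurableSpace Y]
    [DiscreteMeasurableSpace Y] (x₀ : X) (E : ℝ) (t : Y → Set.Icc 0 E) :
    AdaptiveMechanism.{u, v} X Y where
  Out := ULift.{u} Bool
  law x := open Classical in grrKernel E t (decide (x = x₀))
  isMarkovKernel _ := inferInstance

end RandomizedResponse

section Classes

variable {X : Type v} {Nbr : X → X → Prop} {ε : ℝ}

theorem ratioBounded_grr {E : ℝ} (hE : 0 < E) (x₀ : X) (t : Set.Icc 0 E) (x x' : X) :
    RatioBounded E t ((grr.{u, v} x₀ E t).law x) ((grr x₀ E t).law x') ∨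
      RatioBounded E (E - t) ((grr.{u, v} x₀ E t).law x) ((grr x₀ E t).law x') := by
  have h := ratioBounded_grrMeasure hE t
  by_cases hx : x = x₀ <;> by_cases hx' : x' = x₀ <;>
    simp only [grr, hx, hx', decide_true, decide_false]
  · exact .inl (.refl t.2 _)
  · exact .inl h
  · exact .inr h.symm
  · exact .inl (.refl t.2 _)

/-- The class `C` is described by generalized randomized response with parameters `E` and `t ∈ T`:
it contains these mechanisms, and on neighboring inputs the likelihood ratio of every mechanism
in `C` is bounded like the likelihood ratio of one of them. -/
structure IsGrrClass (Nbr : X → X → Prop) (C : Set (Mechanism.{u, v} X)) (E : ℝ) (T : Set ℝ) :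
    Prop where
  pos : 0 < E
  subset_Icc : T ⊆ Set.Icc 0 E
  exists_ratioBounded : ∀ M ∈ C, ∀ x x', Nbr x x' →
    ∃ t ∈ T, RatioBounded E t (M.law x) (M.law x')
  grr_mem : ∀ (x₀ : X) (t : Set.Icc 0 E), (t : ℝ) ∈ T → grr x₀ E t ∈ C

theorem isGrrClass_classBR (Nbr : X → X → Prop) (hε : 0 < ε) :
    IsGrrClass Nbr (classBR.{u, v} Nbr ε) ε (Set.Icc 0 ε) where
  pos := hε
  subset_Icc := subset_rfl
  exists_ratioBounded _ hM x x' hx :=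
    (isBR_iff.1 hM x x' hx).imp fun _ h => ⟨h.mem_Icc, h⟩
  grr_mem x₀ t _ := isBR_iff.2 fun x x' _ =>
    (ratioBounded_grr hε x₀ t x x').elim (fun h => ⟨_, h⟩) fun h => ⟨_, h⟩

theorem isGrrClass_classDP (hsymm : ∀ x x', Nbr x x' → Nbr x' x) (hε : 0 < ε) :
    IsGrrClass Nbr (classDP.{u, v} Nbr ε) (2 * ε) {ε} where
  pos := by linarith
  subset_Icc := Set.singleton_subset_iff.2 ⟨hε.le, by linarith⟩
  exists_ratioBounded _ hM x x' hx := ⟨ε, rfl, (isDP_zero_iff hsymm).1 hM x x' hx⟩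
  grr_mem x₀ t ht := (isDP_zero_iff hsymm).2 fun x x' _ => by
    have h := ratioBounded_grr (by linarith) x₀ t x x'
    rwa [Set.mem_singleton_iff.1 ht, show 2 * ε - ε = ε by ring, or_self] at h

end Classes

/-- The hockey-stick divergence of level `exp s` of generalized randomized response, followed by
mechanisms whose divergence of level `exp r` is `f r` for all `r`: an output of likelihood
ratio `exp t` lowers `s` by `t`. -/
noncomputable def grrProfile (E t : ℝ) (f : ℝ → ℝ) (s : ℝ) : ℝ :=
  qRR E t * f (s - t) + (1 - qRR E t) * f (s + E - t)

/-- The values of `grrProfile E₁ t₁` with `t₁ ∈ T₁`, where `f` is replaced by `grrProfile E₂ t₂ f`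
with a parameter `t₂ ∈ T₂` that may depend on the first output. -/
def grrValues (E₁ : ℝ) (T₁ : Set ℝ) (E₂ : ℝ) (T₂ : Set ℝ) (f : ℝ → ℝ) (s : ℝ) : Set ℝ :=
  {v | ∃ t ∈ T₁, ∃ a ∈ T₂, ∃ b ∈ T₂, v = qRR E₁ t * grrProfile E₂ a f (s - t) +
    (1 - qRR E₁ t) * grrProfile E₂ b f (s + E₁ - t)}

section Profile

variable {E t s : ℝ} {f : ℝ → ℝ}

theorem grrProfile_nonneg (ht : t ∈ Set.Icc 0 E) (hf : ∀ r, 0 ≤ f r) : 0 ≤ grrProfile E t f s :=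
  have hq := qRR_mem_Icc ht
  add_nonneg (mul_nonneg hq.1 (hf _)) (mul_nonneg (sub_nonneg.2 hq.2) (hf _))

theorem grrProfile_comm (E₁ t₁ E₂ t₂ : ℝ) (f : ℝ → ℝ) (s : ℝ) :
    grrProfile E₁ t₁ (grrProfile E₂ t₂ f) s = grrProfile E₂ t₂ (grrProfile E₁ t₁ f) s := by
  unfold grrProfile
  rw [sub_right_comm s t₁, show s + E₁ - t₁ + E₂ - t₂ = s + E₂ - t₂ + E₁ - t₁ by ring,
    show s + E₁ - t₁ - t₂ = s - t₂ + E₁ - t₁ by ring,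
    show s - t₁ + E₂ - t₂ = s + E₂ - t₂ - t₁ by ring]
  ring

variable {Y Z W : Type*} [MeasurableSpace Y] [MeasurableSpace Z] [MeasurableSpace W]
  {P Q : Measure Y} [IsProbabilityMeasure P] [IsProbabilityMeasure Q]
  {κ κ' : Kernel Y Z} [IsMarkovKernel κ] [IsMarkovKernel κ']

theorem RatioBounded.hockeyStick_compProd_le_grrProfile (h : RatioBounded E t P Q) (hE : 0 < E)
    (hf : ∀ y r, hockeyStick r (κ y) (κ' y) ≤ f r) :
    hockeyStick s (P ⊗ₘ κ) (Q ⊗ₘ κ') ≤ grrProfile E t f s :=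
  have hq := qRR_mem_Icc h.mem_Icc
  h.hockeyStick_compProd_le hE fun y y' => add_le_add (mul_le_mul_of_nonneg_left (hf y _) hq.1)
    (mul_le_mul_of_nonneg_left (hf y' _) (sub_nonneg.2 hq.2))

theorem hockeyStick_compProd_compProd_le {E₁ E₂ δ : ℝ} {T₁ T₂ : Set ℝ} (hE₁ : 0 < E₁)
    (hE₂ : 0 < E₂) {η η' : Kernel (Y × Z) W} [IsMarkovKernel η] [IsMarkovKernel η']
    (h₁ : ∃ t ∈ T₁, RatioBounded E₁ t P Q)
    (h₂ : ∀ y, ∃ t ∈ T₂, RatioBounded E₂ t (κ y) (κ' y))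
    (hf : ∀ p r, hockeyStick r (η p) (η' p) ≤ f r)
    (hδ : δ ∈ upperBounds (grrValues E₁ T₁ E₂ T₂ f s)) :
    hockeyStick s (P ⊗ₘ κ ⊗ₘ η) (Q ⊗ₘ κ' ⊗ₘ η') ≤ δ := by
  obtain ⟨t, ht, h₁⟩ := h₁
  have hq := qRR_mem_Icc h₁.mem_Icc
  have second_le (y : Y) (r : ℝ) : ∃ a ∈ T₂,
      hockeyStick r ((κ ⊗ₖ η) y) ((κ' ⊗ₖ η') y) ≤ grrProfile E₂ a f r := by
    obtain ⟨a, ha, h⟩ := h₂ y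
    refine ⟨a, ha, ?_⟩
    rw [Kernel.compProd_apply_eq_compProd_sectR, Kernel.compProd_apply_eq_compProd_sectR]
    refine h.hockeyStick_compProd_le_grrProfile hE₂ fun z r => ?_
    simpa only [Kernel.sectR_apply] using hf (y, z) r
  rw [hockeyStick_compProd_assoc]
  refine h₁.hockeyStick_compProd_le hE₁ fun y y' => ?_
  obtain ⟨a, ha, hle⟩ := second_le y (s - t)
  obtain ⟨b, hb, hle'⟩ := second_le y' (s + E₁ - t)
  exact (add_le_add (mul_le_mul_of_nonneg_left hle hq.1)
    (mul_le_mul_of_nonneg_left hle' (sub_nonneg.2 hq.2))).trans (hδ ⟨t, ht, a, ha, b, hb, rfl⟩)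

/-- After the output `y` of generalized randomized response, the hockey-stick divergence of
level `exp s` continues at the level `exp (grrLevel E t s y)`. -/
def grrLevel (E t s : ℝ) : ULift.{u} Bool → ℝ
  | ⟨true⟩ => s - t
  | ⟨false⟩ => s + E - t

theorem grrProfile_le_hockeyStick_compProd (hE : 0 < E) (t : Set.Icc 0 E)
    {κ κ' : Kernel (ULift.{u} Bool) Z} [IsMarkovKernel κ] [IsMarkovKernel κ']
    (hf : ∀ y, f (grrLevel E t s y) ≤ hockeyStick (grrLevel E t s y) (κ y) (κ' y)) :
    grrProfile E t f s ≤ hockeyStick s (grrMeasure E t true ⊗ₘ κ) (grrMeasure E t false ⊗ₘ κ') :=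
  have hq := qRR_mem_Icc t.2
  (add_le_add (mul_le_mul_of_nonneg_left (hf ⟨true⟩) hq.1)
    (mul_le_mul_of_nonneg_left (hf ⟨false⟩) (sub_nonneg.2 hq.2))).trans
    (le_hockeyStick_grrMeasure_compProd hE t s κ κ')

theorem le_hockeyStick_grrMeasure_compProd_compProd {E₁ E₂ : ℝ} (hE₁ : 0 < E₁) (hE₂ : 0 < E₂)
    (t : Set.Icc 0 E₁) (t₂ : ULift.{u} Bool → Set.Icc 0 E₂)
    {η η' : Kernel (ULift.{u} Bool × ULift.{u} Bool) W} [IsMarkovKernel η] [IsMarkovKernel η']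
    (hf : ∀ y z, f (grrLevel E₂ (t₂ y) (grrLevel E₁ t s y) z) ≤
      hockeyStick (grrLevel E₂ (t₂ y) (grrLevel E₁ t s y) z) (η (y, z)) (η' (y, z))) :
    qRR E₁ t * grrProfile E₂ (t₂ ⟨true⟩) f (s - t) +
        (1 - qRR E₁ t) * grrProfile E₂ (t₂ ⟨false⟩) f (s + E₁ - t) ≤
      hockeyStick s (grrMeasure E₁ t true ⊗ₘ grrKernel E₂ t₂ true ⊗ₘ η)
        (grrMeasure E₁ t false ⊗ₘ grrKernel E₂ t₂ false ⊗ₘ η') := by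
  have hq := qRR_mem_Icc t.2
  have le_second (y : ULift.{u} Bool) : grrProfile E₂ (t₂ y) f (grrLevel E₁ t s y) ≤
      hockeyStick (grrLevel E₁ t s y) ((grrKernel E₂ t₂ true ⊗ₖ η) y)
        ((grrKernel E₂ t₂ false ⊗ₖ η') y) := by
    rw [Kernel.compProd_apply_eq_compProd_sectR, Kernel.compProd_apply_eq_compProd_sectR]
    refine grrProfile_le_hockeyStick_compProd hE₂ (t₂ y) fun z => ?_
    simpa only [Kernel.sectR_apply] using hf y z
  rw [hockeyStick_compProd_assoc]
  exact (add_le_add (mul_le_mul_of_nonneg_left (le_second ⟨true⟩) hq.1)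
    (mul_le_mul_of_nonneg_left (le_second ⟨false⟩) (sub_nonneg.2 hq.2))).trans
    (le_hockeyStick_grrMeasure_compProd hE₁ t s _ _)

end Profile

section BoundedRangeProfile

variable {ε s t : ℝ}

/-- The largest hockey-stick divergence of level `exp s` between the laws of an `ε`-bounded range
mechanism on neighboring inputs. -/
noncomputable def brProfile (ε s : ℝ) : ℝ :=
  if s ≤ -ε then 1 - Real.exp s
  else if s ≤ ε then qRR ε ((s + ε) / 2) ^ 2 * (1 - Real.exp (-ε))
  else 0

theorem qRR_zero (hε : 0 < ε) : qRR ε 0 = 1 := by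
  rw [qRR, zero_sub, div_self (one_sub_exp_neg_pos hε).ne']

theorem qRR_self (ε : ℝ) : qRR ε ε = 0 := by simp [qRR]

theorem brProfile_of_le_neg (hs : s ≤ -ε) : brProfile ε s = 1 - Real.exp s := if_pos hs

theorem brProfile_of_mem_Icc (hε : 0 < ε) (hs : s ∈ Set.Icc (-ε) ε) :
    brProfile ε s = qRR ε ((s + ε) / 2) ^ 2 * (1 - Real.exp (-ε)) := by
  rcases hs.1.eq_or_lt with rfl | hlt
  · rw [brProfile_of_le_neg le_rfl, neg_add_cancel, zero_div, qRR_zero hε, one_pow, one_mul]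
  · rw [brProfile, if_neg hlt.not_ge, if_pos hs.2]

theorem brProfile_of_ge (hε : 0 < ε) (hs : ε ≤ s) : brProfile ε s = 0 := by
  rcases hs.eq_or_lt with rfl | hlt
  · simp [brProfile_of_mem_Icc hε ⟨by linarith, le_rfl⟩, qRR_self]
  · rw [brProfile, if_neg (by linarith), if_neg hlt.not_ge]

theorem qRR_mul_add_one_sub_qRR_mul (hε : 0 < ε) (s t : ℝ) :
    qRR ε t * (1 - Real.exp (s - t)) + (1 - qRR ε t) * (1 - Real.exp (s + ε - t)) =
      1 - Real.exp s := by
  rw [sub_eq_add_neg s t, add_sub_assoc, Real.exp_add, Real.exp_add]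
  linear_combination Real.exp s * one_sub_exp_neg_mul_qRR hε t

theorem one_sub_mul_one_sub_le_sq {a b r : ℝ} (ha : 0 < a) (h : a * b = r ^ 2) :
    (1 - a) * (1 - b) ≤ (1 - r) ^ 2 := by
  have hb : b = r ^ 2 / a := by rw [← h]; field_simp
  have : (1 - r) ^ 2 - (1 - a) * (1 - b) = (a - r) ^ 2 / a := by
    rw [hb]; field_simp; ring
  have : 0 ≤ (a - r) ^ 2 / a := by positivity
  linarith

theorem isGreatest_brProfile (hε : 0 < ε) (s : ℝ) :
    IsGreatest ((fun t => qRR ε t * (1 - Real.exp (s - t))) '' Set.Icc 0 ε) (brProfile ε s) := by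
  have hD := one_sub_exp_neg_pos hε
  refine ⟨?_, ?_⟩
  · rcases le_total s (-ε) with hs | hs
    · exact ⟨0, ⟨le_rfl, hε.le⟩, by simp [qRR_zero hε, brProfile_of_le_neg hs]⟩
    rcases le_total s ε with hs' | hs'
    · refine ⟨(s + ε) / 2, ⟨by linarith, by linarith⟩, ?_⟩
      dsimp only
      rw [brProfile_of_mem_Icc hε ⟨hs, hs'⟩, sq, mul_assoc, qRR_mul hε,
        show s - (s + ε) / 2 = (s + ε) / 2 - ε by ring]
    · exact ⟨ε, ⟨hε.le, le_rfl⟩, by simp [qRR_self, brProfile_of_ge hε hs']⟩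
  · rintro _ ⟨t, ht, rfl⟩
    have hq := qRR_mem_Icc ht
    dsimp only
    rcases le_total s (-ε) with hs | hs
    · rw [brProfile_of_le_neg hs]
      have : 0 ≤ (1 - qRR ε t) * (1 - Real.exp (s + ε - t)) :=
        mul_nonneg (sub_nonneg.2 hq.2) (sub_nonneg.2 (Real.exp_le_one_iff.2 (by linarith [ht.1])))
      linarith [qRR_mul_add_one_sub_qRR_mul hε s t]
    rcases le_total s ε with hs' | hs'
    · refine le_of_mul_le_mul_right ?_ hD
      rw [brProfile_of_mem_Icc hε ⟨hs, hs'⟩, mul_right_comm, qRR_mul hε, mul_assoc, ← sq,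
        ← mul_pow, qRR_mul hε]
      refine one_sub_mul_one_sub_le_sq (Real.exp_pos _) ?_
      rw [← Real.exp_add, ← Real.exp_nat_mul]
      ring_nf
    · rw [brProfile_of_ge hε hs']
      exact mul_nonpos_of_nonneg_of_nonpos hq.1 (by simpa using ht.2.trans hs')

theorem brProfile_nonneg (hε : 0 < ε) (s : ℝ) : 0 ≤ brProfile ε s := by
  simpa [qRR_self] using (isGreatest_brProfile hε s).2 ⟨ε, ⟨hε.le, le_rfl⟩, rfl⟩

theorem exists_brProfile_le_hockeyStick (hε : 0 < ε) (s : ℝ) : ∃ t : Set.Icc 0 ε,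
    brProfile ε s ≤ hockeyStick s (grrMeasure.{u} ε t true) (grrMeasure.{u} ε t false) := by
  obtain ⟨t, ht, h⟩ := (isGreatest_brProfile hε s).1
  exact ⟨⟨t, ht⟩, h.symm.trans_le (le_hockeyStick_grrMeasure hε ⟨t, ht⟩ s)⟩

theorem RatioBounded.hockeyStick_le_brProfile {Y : Type*} [MeasurableSpace Y] {P Q : Measure Y}
    [IsProbabilityMeasure P] [IsProbabilityMeasure Q] (h : RatioBounded ε t P Q) (hε : 0 < ε) :
    hockeyStick s P Q ≤ brProfile ε s := by
  have le_brProfile {t : ℝ} (ht : t ∈ Set.Icc 0 ε) :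
    qRR ε t * (1 - Real.exp (s - t)) ≤ brProfile ε s := (isGreatest_brProfile hε s).2 ⟨t, ht, rfl⟩
  refine (h.hockeyStick_le_max hε).trans ?_
  rcases le_total 0 (s + ε - t) with hst | hst
  · rw [max_eq_left (b := 1 - Real.exp (s + ε - t)) (by simpa using hst), mul_zero, add_zero,
      mul_max_of_nonneg _ _ (qRR_mem_Icc h.mem_Icc).1, mul_zero]
    exact max_le (brProfile_nonneg hε s) (le_brProfile h.mem_Icc)
  · rw [max_eq_right (by simp; linarith), max_eq_right (by simp; linarith),
      qRR_mul_add_one_sub_qRR_mul hε]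
    simpa [qRR_zero hε] using le_brProfile ⟨le_rfl, hε.le⟩

end BoundedRangeProfile

section TripleComposition

variable {X : Type v} {Nbr : X → X → Prop} {C₁ C₂ : Set (Mechanism.{u, v} X)}
  {ε E₁ E₂ s : ℝ} {T₁ T₂ : Set ℝ}

theorem deltaOpt_adaptive₃_le (hε : 0 < ε) (h₁ : IsGrrClass Nbr C₁ E₁ T₁)
    (h₂ : IsGrrClass Nbr C₂ E₂ T₂) {δ : ℝ} (hδ : 0 ≤ δ)
    (h : δ ∈ upperBounds (grrValues E₁ T₁ E₂ T₂ (brProfile ε) s)) :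
    deltaOpt Nbr (adaptive₃ C₁ C₂ (classBR Nbr ε)) s ≤ δ := by
  refine deltaOpt_le hδ ?_
  rintro _ ⟨_, ⟨M₁, hM₁, M₂, hM₂, rfl⟩, M₃, hM₃, rfl⟩ x x' hx
  let η : X → Kernel (M₁.Out × M₂.Out) M₃.Out := M₃.law
  have (x : X) : IsMarkovKernel (η x) := M₃.isMarkovKernel x
  refine hockeyStick_compProd_compProd_le (η := η x) (η' := η x') h₁.pos h₂.pos
    (h₁.exists_ratioBounded M₁ hM₁ x x' hx)
    (fun y => h₂.exists_ratioBounded _ (hM₂ y) x x' hx) (fun p r => ?_) h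
  obtain ⟨t, ht⟩ := isBR_iff.1 (hM₃ p) x x' hx
  exact ht.hockeyStick_le_brProfile hε

theorem mem_grrValues_le_deltaOpt_adaptive₃ (hε : 0 < ε) (h₁ : IsGrrClass Nbr C₁ E₁ T₁)
    (h₂ : IsGrrClass Nbr C₂ E₂ T₂) (hne : ∃ x x', Nbr x x' ∧ x ≠ x') {v : ℝ}
    (hv : v ∈ grrValues E₁ T₁ E₂ T₂ (brProfile ε) s) :
    v ≤ deltaOpt Nbr (adaptive₃ C₁ C₂ (classBR Nbr ε)) s := by
  obtain ⟨x, x', hx, hne⟩ := hne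
  obtain ⟨t, ht, a, ha, b, hb, rfl⟩ := hv
  lift t to Set.Icc 0 E₁ using h₁.subset_Icc ht
  lift a to Set.Icc 0 E₂ using h₂.subset_Icc ha
  lift b to Set.Icc 0 E₂ using h₂.subset_Icc hb
  choose τ hτ using exists_brProfile_le_hockeyStick.{u} hε
  let t₂ : ULift.{u} Bool → Set.Icc 0 E₂ := fun y => if y.down then a else b
  let M₂ : AdaptiveMechanism.{u, v} X (ULift.{u} Bool) := adaptiveGrr x E₂ t₂
  let M₃ : AdaptiveMechanism.{u, v} X (ULift.{u} Bool × ULift.{u} Bool) :=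
    adaptiveGrr x ε fun p => τ (grrLevel E₂ (t₂ p.1) (grrLevel E₁ t s p.1) p.2)
  have hM : ((grr x E₁ t).andThen M₂).andThen M₃ ∈ adaptive₃ C₁ C₂ (classBR Nbr ε) := by
    refine ⟨_, ⟨_, h₁.grr_mem x t ht, M₂, fun y => h₂.grr_mem x _ ?_, rfl⟩, M₃,
      fun p => (isGrrClass_classBR Nbr hε).grr_mem x _ (Subtype.coe_prop _), rfl⟩
    dsimp only [t₂]
    split_ifs <;> assumption
  refine le_trans ?_ (hockeyStick_le_deltaOpt hM hx)
  classical
  have hlaw (x' : X) : (((grr x E₁ t).andThen M₂).andThen M₃).law x' =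
      grrMeasure E₁ t (decide (x' = x)) ⊗ₘ grrKernel E₂ t₂ (decide (x' = x)) ⊗ₘ
        grrKernel ε _ (decide (x' = x)) := rfl
  rw [hlaw, hlaw, decide_eq_true rfl, decide_eq_false hne.symm]
  exact le_hockeyStick_grrMeasure_compProd_compProd h₁.pos h₂.pos t t₂ fun y z => hτ _

theorem deltaOpt_adaptive₃_eq (hε : 0 < ε) (h₁ : IsGrrClass Nbr C₁ E₁ T₁)
    (h₂ : IsGrrClass Nbr C₂ E₂ T₂) (hne : ∃ x x', Nbr x x' ∧ x ≠ x') {v : ℝ}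
    (hv : IsGreatest (grrValues E₁ T₁ E₂ T₂ (brProfile ε) s) v) :
    deltaOpt Nbr (adaptive₃ C₁ C₂ (classBR Nbr ε)) s = v := by
  refine le_antisymm (deltaOpt_adaptive₃_le hε h₁ h₂ ?_ hv.2)
    (mem_grrValues_le_deltaOpt_adaptive₃ hε h₁ h₂ hne hv.1)
  obtain ⟨t, ht, a, ha, b, hb, rfl⟩ := hv.1
  have hq := qRR_mem_Icc (h₁.subset_Icc ht)
  exact add_nonneg
    (mul_nonneg hq.1 (grrProfile_nonneg (h₂.subset_Icc ha) (brProfile_nonneg hε)))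
    (mul_nonneg (sub_nonneg.2 hq.2)
      (grrProfile_nonneg (h₂.subset_Icc hb) (brProfile_nonneg hε)))

end TripleComposition

section Extremal

theorem one_sub_mul_one_sub_sq_lt {a b r : ℝ} (ha : 0 < a) (ha' : a ≤ 1) (hb : 0 < b)
    (hb' : b ≤ 1) (h : a * b ^ 2 = r ^ 3) (hne : a ≠ b) :
    (1 - a) * (1 - b) ^ 2 < (1 - r) ^ 3 := by
  have hsq : 0 < (a - b) ^ 2 := sq_pos_of_ne_zero (sub_ne_zero.2 hne)
  have hr : r < (a + 2 * b) / 3 := by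
    refine lt_of_pow_lt_pow_left₀ 3 (by positivity) ?_
    have : 0 < (a - b) ^ 2 * (a + 8 * b) := mul_pos hsq (by positivity)
    linarith
  calc (1 - a) * (1 - b) ^ 2
      ≤ (1 - (a + 2 * b) / 3) ^ 3 := by
        have : 0 ≤ (a - b) ^ 2 * ((1 - a) + 8 * (1 - b)) := by
          have := sub_nonneg.2 ha'
          have := sub_nonneg.2 hb'
          positivity
        linarith
    _ < (1 - r) ^ 3 := by
        gcongr
        linarith

theorem mul_add_two_mul_sub_le {a c d r : ℝ} (hc : 0 < c) (hr : 0 < r) (h : a * c ^ 2 = r ^ 3)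
    (hdc : d ≤ c) (hdr : d ≤ r) :
    d * (a + 2 * c) - (c ^ 2 + 2 * (a * c)) ≤ d * (r + 2 * r) - (r ^ 2 + 2 * (r * r)) := by
  have ha : a = r ^ 3 / c ^ 2 := by rw [← h]; field_simp
  have hdiff : d * (r + 2 * r) - (r ^ 2 + 2 * (r * r)) - (d * (a + 2 * c) - (c ^ 2 + 2 * (a * c))) =
      (c - r) ^ 2 / c ^ 2 * (c * (c - d) + r * (c - d) + c * (r - d)) := by
    rw [ha]
    field_simp
    ring
  rw [← sub_nonneg, hdiff]
  have := sub_nonneg.2 hdc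
  have := sub_nonneg.2 hdr
  positivity

variable {ε : ℝ} (hε : 0 < ε) {εg s t : ℝ}

include hε

theorem qRR_pos (ht : t < ε) : 0 < qRR ε t := div_pos (by simpa using ht) (by simpa using hε)

theorem one_sub_qRR_two_mul : 1 - qRR (2 * ε) ε = Real.exp (-ε) * qRR (2 * ε) ε := by
  refine mul_right_cancel₀ (one_sub_exp_neg_pos (by linarith : 0 < 2 * ε)).ne' ?_
  rw [one_sub_qRR_mul (by linarith), mul_assoc, qRR_mul (by linarith), mul_sub, ← Real.exp_add]
  ring_nf

theorem yFun_add_zFun_eq_xFun (εg t : ℝ) : yFun ε εg t + zFun ε εg t = xFun ε εg t := by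
  have hD := one_sub_exp_neg_pos hε
  have hsq : Real.exp (εg - ε - t) = Real.exp (-ε) * Real.exp ((εg - t) / 2) ^ 2 := by
    rw [← Real.exp_nat_mul, ← Real.exp_add]
    ring_nf
  have hmul : Real.exp ((εg - t) / 2 - ε) = Real.exp (-ε) * Real.exp ((εg - t) / 2) := by
    rw [← Real.exp_add]
    ring_nf
  have hprofile : 1 - Real.exp (εg - ε - t) +
      Real.exp (-ε) * qRR ε (ε + (εg - t) / 2) ^ 2 * (1 - Real.exp (-ε)) =
      qRR ε ((εg - t) / 2) ^ 2 * (1 - Real.exp (-ε)) := by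
    rw [qRR, qRR, hsq, hmul, add_sub_cancel_left]
    field_simp
    ring
  rw [xFun, yFun, zFun, one_sub_qRR_two_mul hε]
  linear_combination qRR (2 * ε) ε * qRR ε t * hprofile

theorem xFun_eq (εg t : ℝ) : xFun ε εg t = qRR (2 * ε) ε / (1 - Real.exp (-ε)) ^ 2 *
    ((1 - Real.exp (-ε)) * (1 + Real.exp (εg - 2 * ε)) - 4 * (1 - Real.exp (-(ε / 2))) *
      Real.exp (εg / 2 - 5 * ε / 4) * Real.cosh (t / 2 - ε / 4)) := by
  have hD := one_sub_exp_neg_pos hε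
  set a := Real.exp (t - ε) with a_def
  set c := Real.exp ((εg + ε - t) / 2 - ε) with c_def
  set h := Real.exp (-(ε / 2))
  have h_sq : Real.exp (-ε) = h ^ 2 := by
    rw [← Real.exp_nat_mul]
    ring_nf
  have h_mul_c : Real.exp ((εg - t) / 2 - ε) = h * c := by
    rw [← Real.exp_add]
    ring_nf
  have a_mul_c_sq : Real.exp (εg - 2 * ε) = a * c ^ 2 := by
    rw [← Real.exp_nat_mul, ← Real.exp_add]
    ring_nf
  have two_mul_cosh :
      2 * Real.exp (εg / 2 - 5 * ε / 4) * Real.cosh (t / 2 - ε / 4) = h * c + a * c := by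
    rw [Real.cosh_eq, ← Real.exp_add, ← Real.exp_add, mul_right_comm,
      mul_div_cancel₀ _ two_ne_zero, add_mul, ← Real.exp_add, ← Real.exp_add]
    ring_nf
  have cosh_eq : 4 * (1 - h) * Real.exp (εg / 2 - 5 * ε / 4) * Real.cosh (t / 2 - ε / 4) =
      2 * (1 - h) * (h * c + a * c) := by
    linear_combination 2 * (1 - h) * two_mul_cosh
  rw [xFun, cosh_eq]
  generalize qRR (2 * ε) ε = κ
  rw [h_sq] at hD ⊢
  simp only [qRR, ← a_def, ← c_def, a_mul_c_sq, h_mul_c, h_sq]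
  field_simp
  ring

theorem xFun_le_xFun (h : |s - ε / 2| ≤ |t - ε / 2|) : xFun ε εg t ≤ xFun ε εg s := by
  have hκ := qRR_pos (by linarith : 0 < 2 * ε) (by linarith : ε < 2 * ε)
  have hD := one_sub_exp_neg_pos hε
  have hh : 0 < 1 - Real.exp (-(ε / 2)) := one_sub_exp_neg_pos (half_pos hε)
  have hcosh : Real.cosh (s / 2 - ε / 4) ≤ Real.cosh (t / 2 - ε / 4) := by
    rw [Real.cosh_le_cosh, show s / 2 - ε / 4 = (s - ε / 2) / 2 by ring,
      show t / 2 - ε / 4 = (t - ε / 2) / 2 by ring, abs_div, abs_div]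
    gcongr
  rw [xFun_eq hε, xFun_eq hε]
  gcongr

theorem yFun_eq (εg t : ℝ) : yFun ε εg t = qRR (2 * ε) ε / (1 - Real.exp (-ε)) ^ 2 *
    (1 - 2 * Real.exp (-ε) + (2 - Real.exp (-ε)) * Real.exp (εg - 2 * ε) +
      (Real.exp (-ε) * (Real.exp (t - ε) + 2 * Real.exp ((εg - ε - t) / 2)) -
        (Real.exp ((εg - ε - t) / 2) ^ 2 +
          2 * (Real.exp (t - ε) * Real.exp ((εg - ε - t) / 2))))) := by
  have hD := one_sub_exp_neg_pos hε
  have ac : Real.exp (εg - 2 * ε) = Real.exp (t - ε) * Real.exp ((εg - ε - t) / 2) ^ 2 := by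
    rw [← Real.exp_nat_mul, ← Real.exp_add]
    ring_nf
  have cc : Real.exp (εg - ε - t) = Real.exp ((εg - ε - t) / 2) ^ 2 := by
    rw [← Real.exp_nat_mul]
    ring_nf
  rw [yFun]
  generalize qRR (2 * ε) ε = κ
  simp only [qRR, ac, cc, show (εg + ε - t) / 2 - ε = (εg - ε - t) / 2 by ring]
  field_simp
  ring

theorem yFun_le (hεg : -ε ≤ εg) (ht : t ≤ ε + εg) :
    yFun ε εg t ≤ yFun ε εg ((ε + εg) / 3) := by
  have hκ := qRR_pos (by linarith : 0 < 2 * ε) (by linarith : ε < 2 * ε)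
  have hD := one_sub_exp_neg_pos hε
  rw [yFun_eq hε, yFun_eq hε, show (εg - ε - (ε + εg) / 3) / 2 = (ε + εg) / 3 - ε by ring]
  gcongr _ * (_ + ?_)
  refine mul_add_two_mul_sub_le (Real.exp_pos _) (Real.exp_pos _) ?_ (Real.exp_le_exp.2 ?_)
    (Real.exp_le_exp.2 ?_)
  · rw [← Real.exp_nat_mul, ← Real.exp_nat_mul, ← Real.exp_add]
    ring_nf
  · linarith
  · linarith

theorem zFun_eq (εg t : ℝ) : zFun ε εg t = (1 - qRR (2 * ε) ε) / (1 - Real.exp (-ε)) ^ 2 *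
    ((1 - Real.exp (t - ε)) * (1 - Real.exp ((εg - t) / 2)) ^ 2) := by
  have hD := one_sub_exp_neg_pos hε
  rw [zFun]
  generalize qRR (2 * ε) ε = κ
  simp only [qRR, add_sub_cancel_left]
  field_simp

theorem zFun_lt (ht : t ∈ Set.Icc εg ε) (hne : t ≠ (2 * ε + εg) / 3) :
    zFun ε εg t < zFun ε εg ((2 * ε + εg) / 3) := by
  have hκ : 0 < 1 - qRR (2 * ε) ε := by
    rw [one_sub_qRR_two_mul hε]
    exact mul_pos (Real.exp_pos _) (qRR_pos (by linarith : 0 < 2 * ε) (by linarith : ε < 2 * ε))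
  have hD := one_sub_exp_neg_pos hε
  rw [zFun_eq hε, zFun_eq hε, show (εg - (2 * ε + εg) / 3) / 2 = (2 * ε + εg) / 3 - ε by ring,
    ← pow_succ']
  gcongr
  refine one_sub_mul_one_sub_sq_lt (Real.exp_pos _) ?_ (Real.exp_pos _) ?_ ?_ ?_
  · simpa using ht.2
  · exact Real.exp_le_one_iff.2 (by linarith [ht.1])
  · rw [← Real.exp_nat_mul, ← Real.exp_nat_mul, ← Real.exp_add]
    ring_nf
  · rw [Ne, Real.exp_eq_exp]
    contrapose! hne
    linarith

end Extremal

/-- The contribution of the output of likelihood ratio `exp ε` of an extremal `ε`-differentially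
private mechanism to the divergence of level `exp εg`, when the bounded range mechanism that is
composed with it has the parameter `t` at this output. -/
noncomputable def upperBranch (ε εg t : ℝ) : ℝ :=
  qRR (2 * ε) ε * grrProfile ε t (brProfile ε) (εg - ε)

/-- The counterpart of `upperBranch` for the output of likelihood ratio `exp (-ε)`. -/
noncomputable def lowerBranch (ε εg t : ℝ) : ℝ :=
  (1 - qRR (2 * ε) ε) * grrProfile ε t (brProfile ε) (εg + ε)

section Branches

variable {ε : ℝ} (hε : 0 < ε) {εg t : ℝ}

include hε

theorem lowerBranch_nonneg (ht : t ∈ Set.Icc 0 ε) : 0 ≤ lowerBranch ε εg t :=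
  mul_nonneg (sub_nonneg.2 (qRR_mem_Icc ⟨hε.le, by linarith⟩).2)
    (grrProfile_nonneg ht (brProfile_nonneg hε))

theorem lowerBranch_eq_zero (ht : t ≤ εg) : lowerBranch ε εg t = 0 := by
  rw [lowerBranch, grrProfile, brProfile_of_ge hε (by linarith), brProfile_of_ge hε (by linarith)]
  ring

variable (hεg : εg ∈ Set.Ico 0 ε)

include hεg

theorem upperBranch_eq_xFun (ht : t ∈ Set.Icc 0 εg) : upperBranch ε εg t = xFun ε εg t := by
  obtain ⟨-, hεg₁⟩ := hεg
  obtain ⟨ht₀, ht₁⟩ := ht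
  rw [upperBranch, grrProfile, xFun, brProfile_of_mem_Icc hε ⟨by linarith, by linarith⟩,
    brProfile_of_mem_Icc hε ⟨by linarith, by linarith⟩]
  ring_nf

theorem upperBranch_eq_yFun (ht : t ∈ Set.Icc εg ε) : upperBranch ε εg t = yFun ε εg t := by
  obtain ⟨hεg₀, -⟩ := hεg
  obtain ⟨ht₀, ht₁⟩ := ht
  rw [upperBranch, grrProfile, yFun, brProfile_of_le_neg (by linarith),
    brProfile_of_mem_Icc hε ⟨by linarith, by linarith⟩]
  ring_nf

theorem lowerBranch_eq_zFun (ht : t ∈ Set.Icc εg ε) : lowerBranch ε εg t = zFun ε εg t := by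
  obtain ⟨hεg₀, -⟩ := hεg
  obtain ⟨ht₀, ht₁⟩ := ht
  rw [lowerBranch, grrProfile, zFun, brProfile_of_mem_Icc hε ⟨by linarith, by linarith⟩,
    brProfile_of_ge hε (by linarith)]
  ring_nf

theorem upperBranch_add_lowerBranch (ht : t ∈ Set.Icc 0 ε) :
    upperBranch ε εg t + lowerBranch ε εg t = xFun ε εg t := by
  rcases le_total t εg with h | h
  · rw [upperBranch_eq_xFun hε hεg ⟨ht.1, h⟩, lowerBranch_eq_zero hε h, add_zero]
  · rw [upperBranch_eq_yFun hε hεg ⟨h, ht.2⟩, lowerBranch_eq_zFun hε hεg ⟨h, ht.2⟩,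
      yFun_add_zFun_eq_xFun hε]

theorem isMaxOn_upperBranch_of_half_le (h : ε / 2 ≤ εg) :
    IsMaxOn (upperBranch ε εg) (Set.Icc 0 ε) (ε / 2) := by
  intro t ht
  calc upperBranch ε εg t ≤ upperBranch ε εg t + lowerBranch ε εg t :=
        le_add_of_nonneg_right (lowerBranch_nonneg hε ht)
    _ = xFun ε εg t := upperBranch_add_lowerBranch hε hεg ht
    _ ≤ xFun ε εg (ε / 2) := xFun_le_xFun hε (by simp)
    _ = upperBranch ε εg (ε / 2) := (upperBranch_eq_xFun hε hεg ⟨by linarith, h⟩).symm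

theorem isMaxOn_upperBranch_of_lt_half (h : εg < ε / 2) :
    IsMaxOn (upperBranch ε εg) (Set.Icc 0 ε) ((ε + εg) / 3) := by
  have ⟨hεg₀, hεg₁⟩ := hεg
  have le_of_ge {t : ℝ} (ht : t ∈ Set.Icc εg ε) :
      upperBranch ε εg t ≤ upperBranch ε εg ((ε + εg) / 3) := by
    rw [upperBranch_eq_yFun hε hεg ht, upperBranch_eq_yFun hε hεg ⟨by linarith, by linarith⟩]
    exact yFun_le hε (by linarith) (by linarith [ht.2])
  intro t ht
  rcases le_total εg t with hle | hle
  · exact le_of_ge ⟨hle, ht.2⟩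
  calc upperBranch ε εg t = xFun ε εg t := upperBranch_eq_xFun hε hεg ⟨ht.1, hle⟩
    _ ≤ xFun ε εg εg := by
        refine xFun_le_xFun hε ?_
        rw [abs_of_neg (by linarith), abs_of_neg (by linarith)]
        linarith
    _ = upperBranch ε εg εg := (upperBranch_eq_xFun hε hεg ⟨hεg₀, le_rfl⟩).symm
    _ ≤ upperBranch ε εg ((ε + εg) / 3) := le_of_ge ⟨le_rfl, hεg₁.le⟩

theorem lowerBranch_lt (ht : t ∈ Set.Icc 0 ε) (hne : t ≠ (2 * ε + εg) / 3) :
    lowerBranch ε εg t < lowerBranch ε εg ((2 * ε + εg) / 3) := by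
  have ⟨_, hεg₁⟩ := hεg
  have lt_of_ge {t : ℝ} (ht : t ∈ Set.Icc εg ε) (hne : t ≠ (2 * ε + εg) / 3) :
      lowerBranch ε εg t < lowerBranch ε εg ((2 * ε + εg) / 3) := by
    rw [lowerBranch_eq_zFun hε hεg ht, lowerBranch_eq_zFun hε hεg ⟨by linarith, by linarith⟩]
    exact zFun_lt hε ht hne
  rcases le_total εg t with hle | hle
  · exact lt_of_ge ⟨hle, ht.2⟩ hne
  · rw [lowerBranch_eq_zero hε hle, ← lowerBranch_eq_zero hε le_rfl]
    exact lt_of_ge ⟨le_rfl, hεg₁.le⟩ (by linarith)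

theorem isMaxOn_lowerBranch :
    IsMaxOn (lowerBranch ε εg) (Set.Icc 0 ε) ((2 * ε + εg) / 3) := by
  intro t ht
  obtain rfl | hne := eq_or_ne t ((2 * ε + εg) / 3)
  · exact le_refl (lowerBranch ε εg _)
  · exact (lowerBranch_lt hε hεg ht hne).le

end Branches

section OptimalPrivacyParameters

variable {X : Type v} {Nbr : X → X → Prop} {ε εg t t' : ℝ}

theorem mem_grrValues_DP_BR {v : ℝ} :
    v ∈ grrValues (2 * ε) {ε} ε (Set.Icc 0 ε) (brProfile ε) εg ↔
      ∃ t ∈ Set.Icc 0 ε, ∃ t' ∈ Set.Icc 0 ε, v = upperBranch ε εg t + lowerBranch ε εg t' := by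
  simp only [grrValues, Set.mem_ofPred_eq, Set.mem_singleton_iff, exists_eq_left, upperBranch,
    lowerBranch, show εg + 2 * ε - ε = εg + ε by ring]

theorem upperBranch_add_lowerBranch_le_deltaOpt_DP_BR_BR (hsymm : ∀ x x', Nbr x x' → Nbr x' x)
    (hne : ∃ x x', Nbr x x' ∧ x ≠ x') (hε : 0 < ε) (ht : t ∈ Set.Icc 0 ε)
    (ht' : t' ∈ Set.Icc 0 ε) : upperBranch ε εg t + lowerBranch ε εg t' ≤
      deltaOpt Nbr (adaptive₃ (classDP.{u, v} Nbr ε) (classBR Nbr ε) (classBR Nbr ε)) εg :=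
  mem_grrValues_le_deltaOpt_adaptive₃ hε (isGrrClass_classDP hsymm hε) (isGrrClass_classBR Nbr hε)
    hne (mem_grrValues_DP_BR.2 ⟨t, ht, t', ht', rfl⟩)

theorem deltaOpt_DP_BR_BR_eq_add (hsymm : ∀ x x', Nbr x x' → Nbr x' x)
    (hne : ∃ x x', Nbr x x' ∧ x ≠ x') (hε : 0 < ε) (ht : t ∈ Set.Icc 0 ε) (ht' : t' ∈ Set.Icc 0 ε)
    (hmax : IsMaxOn (upperBranch ε εg) (Set.Icc 0 ε) t)
    (hmax' : IsMaxOn (lowerBranch ε εg) (Set.Icc 0 ε) t') :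
    deltaOpt Nbr (adaptive₃ (classDP.{u, v} Nbr ε) (classBR Nbr ε) (classBR Nbr ε)) εg =
      upperBranch ε εg t + lowerBranch ε εg t' := by
  refine deltaOpt_adaptive₃_eq hε (isGrrClass_classDP hsymm hε) (isGrrClass_classBR Nbr hε) hne
    ⟨mem_grrValues_DP_BR.2 ⟨t, ht, t', ht', rfl⟩, fun v hv => ?_⟩
  obtain ⟨a, ha, b, hb, rfl⟩ := mem_grrValues_DP_BR.1 hv
  exact add_le_add (hmax ha) (hmax' hb)

theorem deltaOpt_BR_DP_BR_eq_add (hsymm : ∀ x x', Nbr x x' → Nbr x' x)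
    (hne : ∃ x x', Nbr x x' ∧ x ≠ x') (hε : 0 < ε) (ht : t ∈ Set.Icc 0 ε)
    (hmax : IsMaxOn (fun t => upperBranch ε εg t + lowerBranch ε εg t) (Set.Icc 0 ε) t) :
    deltaOpt Nbr (adaptive₃ (classBR.{u, v} Nbr ε) (classDP Nbr ε) (classBR Nbr ε)) εg =
      upperBranch ε εg t + lowerBranch ε εg t := by
  have value_eq (t : ℝ) : grrProfile ε t (grrProfile (2 * ε) ε (brProfile ε)) εg =
      upperBranch ε εg t + lowerBranch ε εg t := by
    rw [grrProfile_comm, grrProfile, upperBranch, lowerBranch, show εg + 2 * ε - ε = εg + ε by ring]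
  refine deltaOpt_adaptive₃_eq hε (isGrrClass_classBR Nbr hε) (isGrrClass_classDP hsymm hε) hne
    ⟨⟨t, ht, ε, rfl, ε, rfl, (value_eq t).symm⟩, ?_⟩
  rintro _ ⟨t', ht', _, rfl, _, rfl, rfl⟩
  exact (value_eq t').trans_le (hmax ht')

variable (hsymm : ∀ x x', Nbr x x' → Nbr x' x) (hne : ∃ x x', Nbr x x' ∧ x ≠ x')
  (hεg : εg ∈ Set.Ico 0 ε)

include hsymm hne hεg

theorem deltaOpt_BR_DP_BR_eq_xFun :
    deltaOpt Nbr (adaptive₃ (classBR.{u, v} Nbr ε) (classDP Nbr ε) (classBR Nbr ε)) εg =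
      xFun ε εg (ε / 2) := by
  have hε : 0 < ε := hεg.1.trans_lt hεg.2
  have hmid : ε / 2 ∈ Set.Icc 0 ε := ⟨by linarith, by linarith⟩
  rw [← upperBranch_add_lowerBranch hε hεg hmid]
  refine deltaOpt_BR_DP_BR_eq_add hsymm hne hε hmid fun t ht => ?_
  change upperBranch ε εg t + lowerBranch ε εg t ≤
    upperBranch ε εg (ε / 2) + lowerBranch ε εg (ε / 2)
  rw [upperBranch_add_lowerBranch hε hεg ht, upperBranch_add_lowerBranch hε hεg hmid]
  exact xFun_le_xFun hε (by simp)

theorem deltaOpt_DP_BR_BR_of_half_le (h : ε / 2 ≤ εg) :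
    deltaOpt Nbr (adaptive₃ (classDP.{u, v} Nbr ε) (classBR Nbr ε) (classBR Nbr ε)) εg =
      xFun ε εg (ε / 2) + zFun ε εg ((2 * ε + εg) / 3) := by
  have hε : 0 < ε := hεg.1.trans_lt hεg.2
  have hεg_lt := hεg.2
  rw [← upperBranch_eq_xFun hε hεg ⟨by linarith, h⟩,
    ← lowerBranch_eq_zFun hε hεg ⟨by linarith, by linarith⟩]
  exact deltaOpt_DP_BR_BR_eq_add hsymm hne hε ⟨by linarith, by linarith⟩
    ⟨by linarith, by linarith⟩ (isMaxOn_upperBranch_of_half_le hε hεg h)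
    (isMaxOn_lowerBranch hε hεg)

theorem deltaOpt_DP_BR_BR_of_lt_half (h : εg < ε / 2) :
    deltaOpt Nbr (adaptive₃ (classDP.{u, v} Nbr ε) (classBR Nbr ε) (classBR Nbr ε)) εg =
      yFun ε εg ((ε + εg) / 3) + zFun ε εg ((2 * ε + εg) / 3) := by
  have hε : 0 < ε := hεg.1.trans_lt hεg.2
  have hεg_nonneg := hεg.1
  rw [← upperBranch_eq_yFun hε hεg ⟨by linarith, by linarith⟩,
    ← lowerBranch_eq_zFun hε hεg ⟨by linarith, by linarith⟩]
  exact deltaOpt_DP_BR_BR_eq_add hsymm hne hε ⟨by linarith, by linarith⟩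
    ⟨by linarith, by linarith⟩ (isMaxOn_upperBranch_of_lt_half hε hεg h)
    (isMaxOn_lowerBranch hε hεg)

theorem deltaOpt_BR_DP_BR_lt_deltaOpt_DP_BR_BR :
    deltaOpt Nbr (adaptive₃ (classBR.{u, v} Nbr ε) (classDP Nbr ε) (classBR Nbr ε)) εg <
      deltaOpt Nbr (adaptive₃ (classDP.{u, v} Nbr ε) (classBR Nbr ε) (classBR Nbr ε)) εg := by
  have hε : 0 < ε := hεg.1.trans_lt hεg.2
  have hεg_nonneg := hεg.1
  have hεg_lt := hεg.2
  have hmid : ε / 2 ∈ Set.Icc 0 ε := ⟨by linarith, by linarith⟩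
  have hthird : (2 * ε + εg) / 3 ∈ Set.Icc 0 ε := ⟨by linarith, by linarith⟩
  calc deltaOpt Nbr (adaptive₃ (classBR.{u, v} Nbr ε) (classDP Nbr ε) (classBR Nbr ε)) εg
      = upperBranch ε εg (ε / 2) + lowerBranch ε εg (ε / 2) := by
        rw [deltaOpt_BR_DP_BR_eq_xFun hsymm hne hεg, upperBranch_add_lowerBranch hε hεg hmid]
    _ < upperBranch ε εg (ε / 2) + lowerBranch ε εg ((2 * ε + εg) / 3) := by
        gcongr
        exact lowerBranch_lt hε hεg hmid (by linarith)
    _ ≤ _ := upperBranch_add_lowerBranch_le_deltaOpt_DP_BR_BR hsymm hne hε hmid hthird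

end OptimalPrivacyParameters

theorem mainTheorem3 {X : Type v} (Nbr : X → X → Prop)
    (hsymm : ∀ x x', Nbr x x' → Nbr x' x)
    (hne : ∃ x x', Nbr x x' ∧ x ≠ x')
    (ε εg : ℝ) (hεg : 0 ≤ εg) (hε : εg < ε) :
    deltaOpt Nbr (adaptive₃ (classBR.{u, v} Nbr ε) (classDP Nbr ε) (classBR Nbr ε)) εg <
        deltaOpt Nbr (adaptive₃ (classDP.{u, v} Nbr ε) (classBR Nbr ε) (classBR Nbr ε)) εg ∧
      deltaOpt Nbr (adaptive₃ (classDP.{u, v} Nbr ε) (classBR Nbr ε) (classBR Nbr ε)) εg =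
        (if ε / 2 ≤ εg then
          xFun ε εg (ε / 2) + zFun ε εg ((2 * ε + εg) / 3)
        else
          yFun ε εg ((ε + εg) / 3) + zFun ε εg ((2 * ε + εg) / 3)) ∧
      deltaOpt Nbr (adaptive₃ (classBR.{u, v} Nbr ε) (classDP Nbr ε) (classBR Nbr ε)) εg =
        (if ε / 2 ≤ εg then
          max (xFun ε εg (ε / 2)) (yFun ε εg εg + zFun ε εg εg)
        else
          max (xFun ε εg εg) (yFun ε εg (ε / 2) + zFun ε εg (ε / 2))) := by
  have hε₀ : 0 < ε := hεg.trans_lt hε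
  have hxFun : xFun ε εg εg ≤ xFun ε εg (ε / 2) := xFun_le_xFun hε₀ (by simp)
  refine ⟨deltaOpt_BR_DP_BR_lt_deltaOpt_DP_BR_BR hsymm hne ⟨hεg, hε⟩, ?_, ?_⟩
  · split_ifs with h
    · exact deltaOpt_DP_BR_BR_of_half_le hsymm hne ⟨hεg, hε⟩ h
    · exact deltaOpt_DP_BR_BR_of_lt_half hsymm hne ⟨hεg, hε⟩ (not_le.1 h)
  · rw [yFun_add_zFun_eq_xFun hε₀, yFun_add_zFun_eq_xFun hε₀, max_eq_left hxFun,
      max_eq_right hxFun, ite_self]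
    exact deltaOpt_BR_DP_BR_eq_xFun hsymm hne ⟨hεg, hε⟩
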